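/- Let $n,d$ be natural numbers, $Y=(0,1)^d$, $\Theta=[-\pi,\pi)^d$, and let $a\in L^\infty(\mathbb R^d;L(\mathbb C^{n\times d}))$ be $\mathbb Z^d$-periodic with $\Re a\ge \nu 1_{\mathbb C^{n\times d}}$ a.e. for some $\nu>0$ (where $\mathbb C^{n\times d}$ carries the inner product $\langle X,Z\rangle=\sum_{i,j}X_{ij}\overline{Z_{ij}}$). Write $a_{ijkl}(y)$ for the entries of $a(y)$, i.e. $(a(y)X)_{ij}=\sum_{k,l}a_{ijkl}(y)X_{kl}$. For $\theta\in\Theta$ let $H^1_\theta(Y)$ be the closure in $H^1(Y)$ of the smooth functions $\phi:\mathbb R^d\to\mathbb C$ with $\phi(\cdot+k)=e^{\mathrm i\theta\cdot k}\phi(\cdot)$ for all $k\in\mathbb Z^d$, let $\nabla u=(\partial_ju_i)_{ij}$, and let $\mathcal H_\theta=[H^1_\theta(Y)\perp e^{\mathrm i\theta\cdot y}]^n$ be the space of those $u\in[H^1_\theta(Y)]^n$ all of whose components are orthogonal to $y\mapsto e^{\mathrm i\theta\cdot y}$ in $L^2(Y)$. Then for every $\theta\in\Theta$, $r\in\{1,\dots,n\}$,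 $s\in\{1,\dots,d\}$ there is a unique $N^{(rs)}_\theta\in\mathcal H_\theta$ with $$\int_Y\big\langle a(y)\big[\nabla N^{(rs)}_\theta(y)+e^{\mathrm i\theta\cdot y}\,e_r\otimes e_s\big],\nabla\phi(y)\big\rangle\,dy=0\qquad\text{for all }\phi\in\mathcal H_\theta .$$ Define the fibre-homogenised tensor $a^{\mathrm{hom}}(\theta)\in L(\mathbb C^{n\times d})$ by $(a^{\mathrm{hom}}(\theta)X)_{ij}=\sum_{r,s}a^{\mathrm{hom}}_{ijrs}(\theta)X_{rs}$ with $$a^{\mathrm{hom}}_{ijrs}(\theta)=\sum_{k=1}^n\sum_{l=1}^d\int_Y a_{ijkl}(y)\big(\partial_lN^{(rs)}_{\theta,k}(y)+e^{\mathrm i\theta\cdot y}\delta_{kr}\delta_{ls}\big)e^{-\mathrm i\theta\cdot y}\,dy .$$ There exists $\kappa>0$ (depending on $n$, $d$, $a$, but not on $\theta$) such that for all $\theta\in\Theta$ $$\|a^{\mathrm{hom}}(\theta)-a^{\mathrm{hom}}(0)\|\le\kappa|\theta|,$$ where $\|\cdot\|$ is the operator norm on $L(\mathbb C^{n\times d})$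 and $|\theta|$ the Euclidean norm. -/

import Mathlib

open MeasureTheory
open scoped ContDiff

namespace FibreHom

noncomputable section

/-- `ℝ^d` with the Euclidean norm. -/
abbrev RR (d : ℕ) : Type := EuclideanSpace ℝ (Fin d)

/-- `ℂ^n` with the Euclidean norm. -/
abbrev CVec (n : ℕ) : Type := EuclideanSpace ℂ (Fin n)

/-- `ℂ^{n×d}` with the Frobenius (Hilbert space) norm; the entry in row `i` and column `j` of `X`
is `X (i, j)`. -/
abbrev CMat (n d : ℕ) : Type := EuclideanSpace ℂ (Fin n × Fin d)

/-- The matrix unit `e_r ⊗ e_s` in `ℂ^{n×d}`. -/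
def unitMat {n d : ℕ} (r : Fin n) (s : Fin d) : CMat n d := EuclideanSpace.single (r, s) 1

/-- The integer vector `k`, as a vector of `ℝ^d`. -/
def intVec {d : ℕ} (k : Fin d → ℤ) : RR d := WithLp.toLp 2 fun j => (k j : ℝ)

/-- The periodicity cell `Y = (0,1)^d`. -/
def cell (d : ℕ) : Set (RR d) := {y | ∀ j, y j ∈ Set.Ioo (0 : ℝ) 1}

/-- The set of quasi-momenta `Θ = [-π,π)^d`. -/
def Theta (d : ℕ) : Set (RR d) := {θ | ∀ j, θ j ∈ Set.Ico (-Real.pi) Real.pi}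

/-- Lebesgue measure on the cell `Y`. -/
def cellMeasure (d : ℕ) : Measure (RR d) := volume.restrict (cell d)

/-- `[L²(Y)]^n`. -/
abbrev L2Vec (n d : ℕ) : Type := Lp (CVec n) 2 (cellMeasure d)

/-- `[L²(Y)]^{n×d}`. -/
abbrev L2Mat (n d : ℕ) : Type := Lp (CMat n d) 2 (cellMeasure d)

/-- The plane wave `e^{i⟨θ,y⟩}`. -/
def planeWave {d : ℕ} (θ y : RR d) : ℂ := Complex.exp (Complex.I * ((inner ℝ θ y : ℝ) : ℂ))

/-- The class of coefficients `a ∈ L^∞(ℝ^d; L(ℂ^{n×d}))` that are `ℤ^d`-periodic and satisfy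
`Re a ≥ ν` for some `ν > 0`. -/
structure IsCoeff {n d : ℕ} (a : RR d → (CMat n d →L[ℂ] CMat n d)) : Prop where
  memLp_top : MemLp a ⊤ volume
  periodic : ∀ k : Fin d → ℤ, ∀ᵐ y ∂volume, a (y + intVec k) = a y
  coercive : ∃ ν : ℝ, 0 < ν ∧
    ∀ᵐ y ∂volume, ∀ X : CMat n d, ν * ‖X‖ ^ 2 ≤ (inner ℂ X (a y X)).re

/-- `φ ∈ [C^∞_θ(Y)]^n`: `φ` is smooth on `ℝ^d` and `φ(· + k) = e^{i⟨θ,k⟩} φ` for `k ∈ ℤ^d`. -/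
structure IsSmoothQuasiPeriodic {n d : ℕ} (θ : RR d) (φ : RR d → CVec n) : Prop where
  contDiff : ContDiff ℝ ∞ φ
  quasiPeriodic : ∀ (k : Fin d → ℤ) (y : RR d), φ (y + intVec k) = planeWave θ (intVec k) • φ y

/-- The classical gradient `(∂_j φ_i)_{i,j}` at `y`. -/
def classicalGrad {n d : ℕ} (φ : RR d → CVec n) (y : RR d) : CMat n d :=
  WithLp.toLp 2 fun ij => fderiv ℝ φ y (EuclideanSpace.single ij.2 1) ij.1

/-- The graph of `grad_θ` on `[C^∞_θ(Y)]^n`. -/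
def smoothGraph (n : ℕ) {d : ℕ} (θ : RR d) : Set (L2Vec n d × L2Mat n d) :=
  {w | ∃ φ : RR d → CVec n, IsSmoothQuasiPeriodic θ φ ∧
    w.1 =ᵐ[cellMeasure d] φ ∧ w.2 =ᵐ[cellMeasure d] classicalGrad φ}

/-- `[H^1_θ(Y)]^n`, a function `u` being recorded together with its gradient, as the pair
`(u, grad_θ u)`. Under `u ↦ (u, grad u)` the `H^1(Y)`-norm is the graph norm, so that the closure
of `[C^∞_θ(Y)]^n` in `[H^1(Y)]^n` becomes the closure of the graph of the classical gradient in
`[L²(Y)]^n × [L²(Y)]^{n×d}` (a limit of gradients is the weak gradient of the limit). -/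
def H1 (n : ℕ) {d : ℕ} (θ : RR d) : Set (L2Vec n d × L2Mat n d) := closure (smoothGraph n θ)

/-- `[H^1_θ(Y) ⊥ e^{i⟨θ,·⟩}]^n`: the `u` in `[H^1_θ(Y)]^n` each of whose components is
`L²(Y)`-orthogonal to the plane wave (again recorded as pairs `(u, grad_θ u)`). -/
def H1perp (n : ℕ) {d : ℕ} (θ : RR d) : Set (L2Vec n d × L2Mat n d) :=
  {w | w ∈ H1 n θ ∧
    ∀ i : Fin n, ∫ y, w.1 y i * (starRingEnd ℂ) (planeWave θ y) ∂(cellMeasure d) = 0}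

/-- `N = (N_θ^{(rs)}, grad_θ N_θ^{(rs)})` solves the cell problem
`⟨a [grad_θ N + e^{i⟨θ,·⟩} e_r ⊗ e_s], grad_θ φ⟩ = 0` for all `φ ∈ [H^1_θ(Y) ⊥ e^{i⟨θ,·⟩}]^n`.
(Mathlib's `inner ℂ x y` is linear in `y`.) -/
def IsCellSolution {n d : ℕ} (a : RR d → (CMat n d →L[ℂ] CMat n d)) (θ : RR d)
    (r : Fin n) (s : Fin d) (N : L2Vec n d × L2Mat n d) : Prop :=
  N ∈ H1perp n θ ∧ ∀ φ ∈ H1perp n θ,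
    ∫ y, inner ℂ (φ.2 y) (a y (N.2 y + planeWave θ y • unitMat r s)) ∂(cellMeasure d) = 0

/-- The solution `(N_θ^{(rs)}, grad_θ N_θ^{(rs)})` of the cell problem. -/
def cellSolution {n d : ℕ} (a : RR d → (CMat n d →L[ℂ] CMat n d)) (θ : RR d)
    (r : Fin n) (s : Fin d) : L2Vec n d × L2Mat n d :=
  Classical.epsilon (IsCellSolution a θ r s)

/-- The entries of the tensor `a(y)`: `(a(y) X)_{ij} = ∑_{k,l} a_{ijkl}(y) X_{kl}`. -/
def coeffEntry {n d : ℕ} (a : RR d → (CMat n d →L[ℂ] CMat n d)) (i : Fin n) (j : Fin d)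
    (k : Fin n) (l : Fin d) (y : RR d) : ℂ :=
  a y (unitMat k l) (i, j)

/-- The entries of the fibre-homogenised tensor,
`a^hom_{ijrs}(θ) = ∑_{k,l} ∫_Y a_{ijkl} (∂_l N_{θ,k}^{(rs)} + e^{iθ·y} δ_{kr} δ_{ls}) e^{-iθ·y} dy`;
rows are indexed by `(i, j)` and columns by `(r, s)`. -/
def ahomMatrix {n d : ℕ} (a : RR d → (CMat n d →L[ℂ] CMat n d)) (θ : RR d) :
    Matrix (Fin n × Fin d) (Fin n × Fin d) ℂ :=
  fun ij rs => ∑ k : Fin n, ∑ l : Fin d,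
    ∫ y, coeffEntry a ij.1 ij.2 k l y *
      ((cellSolution a θ rs.1 rs.2).2 y (k, l) +
        planeWave θ y * (if k = rs.1 then 1 else 0) * (if l = rs.2 then 1 else 0)) *
      planeWave (-θ) y ∂(cellMeasure d)

/-- The fibre-homogenised tensor `a^hom(θ)` as an operator on the Hilbert space `ℂ^{n×d}`. -/
def ahom {n d : ℕ} (a : RR d → (CMat n d →L[ℂ] CMat n d)) (θ : RR d) :
    CMat n d →L[ℂ] CMat n d :=
  Matrix.toEuclideanCLM (𝕜 := ℂ) (n := Fin n × Fin d) (ahomMatrix a θ)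

end

end FibreHom

/-! Multiplication by `e^{iθ·y}` maps the space of admissible functions at `0` into the one at `θ`,
commutes with `a`, and adds `i u ⊗ θ` to the gradient of `u` (`gaugeShift`). So `e^{iθ·y} N₀` is a
competitor for `N_θ`, and it is enough to estimate the error `e = N_θ - e^{iθ·y} N₀`. Test the
problem at `θ` with `e`, test the problem at `0` with `e^{-iθ·y} e`, and subtract: besides `⟨∇e, a
∇e⟩` only terms containing `i N₀ ⊗ θ` or `i e ⊗ θ` survive. Coercivity then yields `‖∇e‖ ≤ C |θ|`
(`mul_norm_le_of_inner_eq_zero`), once `‖e‖ ≤ ‖∇e‖` is known uniformly in `θ`.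

That bound is a Poincaré inequality (`pi_mul_norm_le`), read off from Parseval for the waves
`e^{i(θ+2πk)·y}`. The gradient multiplies the `k`-th coefficient by `i(θ+2πk)`, of length at least
`π` unless `k = 0`, and the mode `k = 0` is removed by the orthogonality constraint. The same
inequality makes the space of gradients closed, so Lax–Milgram gives the unique `N_θ`.

Finally the entries of `a^hom(θ)` are `⟨e^{iθ·y} e_i⊗e_j, a(∇N_θ + e^{iθ·y} e_r⊗e_s)⟩`
(`ahomMatrix_eq_inner`). Undoing the modulation, the difference from `θ = 0` involves only `∇e` and
`i N₀ ⊗ θ`, both of order `|θ|`. -/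

namespace FibreHom

noncomputable section

/-! ### The cell as a model of the torus -/

/-- The normalised Haar measure on the torus `(ℝ/ℤ)^d`. -/
def torusMeasure (d : ℕ) : Measure (UnitAddTorus (Fin d)) :=
  Measure.pi fun _ => AddCircle.haarAddCircle

instance (d : ℕ) : (torusMeasure d).IsAddHaarMeasure := by
  unfold torusMeasure; infer_instance

instance (d : ℕ) : IsProbabilityMeasure (torusMeasure d) := by
  unfold torusMeasure; infer_instance

/-- The projection of `ℝ^d` onto the torus. -/
def toTorus {d : ℕ} (y : RR d) : UnitAddTorus (Fin d) := fun j => (y j : UnitAddCircle)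

/-- The representative in `(0,1]^d` of a point of the torus. -/
def fromTorus {d : ℕ} (x : UnitAddTorus (Fin d)) : RR d :=
  WithLp.toLp 2 fun j => (AddCircle.equivIoc (1 : ℝ) 0 (x j) : ℝ)

lemma toTorus_add {d : ℕ} (y z : RR d) : toTorus (y + z) = toTorus y + toTorus z := by
  funext j; simp [toTorus]

@[simp] lemma toTorus_fromTorus {d : ℕ} (x : UnitAddTorus (Fin d)) :
    toTorus (fromTorus x) = x := by
  funext j
  exact (AddCircle.equivIoc (1 : ℝ) 0).symm_apply_apply (x j)

lemma fromTorus_toTorus {d : ℕ} {y : RR d} (hy : y ∈ cell d) : fromTorus (toTorus y) = y := by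
  ext j
  have h : y j ∈ Set.Ioc (0 : ℝ) (0 + 1) := ⟨(hy j).1, by linarith [(hy j).2]⟩
  exact congrArg Subtype.val ((AddCircle.equivIoc (1 : ℝ) 0).apply_symm_apply ⟨y j, h⟩)

lemma exists_fromTorus_toTorus {d : ℕ} (y : RR d) :
    ∃ k : Fin d → ℤ, fromTorus (toTorus y) = y + intVec k := by
  have h : ∀ j, ∃ m : ℤ, fromTorus (toTorus y) j = y j + m := by
    intro j
    have h1 : ((fromTorus (toTorus y) j - y j : ℝ) : UnitAddCircle) = 0 := by
      have := congrFun (toTorus_fromTorus (toTorus y)) j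
      rw [AddCircle.coe_sub, sub_eq_zero]
      exact this
    obtain ⟨m, hm⟩ := (AddCircle.coe_eq_zero_iff (1 : ℝ)).1 h1
    refine ⟨m, ?_⟩
    simp only [zsmul_eq_mul, mul_one] at hm
    linarith
  choose k hk using h
  exact ⟨k, by ext j; simpa [intVec] using hk j⟩

lemma measurable_toTorus {d : ℕ} : Measurable (toTorus (d := d)) := by
  refine measurable_pi_lambda _ fun j => ?_
  exact AddCircle.measurable_mk'.comp (by fun_prop)

lemma measurable_fromTorus {d : ℕ} : Measurable (fromTorus (d := d)) := by
  have h : Measurable fun (x : UnitAddTorus (Fin d)) (j : Fin d) =>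
      (AddCircle.equivIoc (1 : ℝ) 0 (x j) : ℝ) := by
    refine measurable_pi_lambda _ fun j => ?_
    exact measurable_subtype_coe.comp
      ((AddCircle.measurableEquivIoc (1 : ℝ) 0).measurable.comp (measurable_pi_apply j))
  exact (WithLp.measurable_toLp 2 _).comp h

lemma measurableSet_cell (d : ℕ) : MeasurableSet (cell d) := by
  have : cell d = ⋂ j, (fun y : RR d => y j) ⁻¹' Set.Ioo (0 : ℝ) 1 := by
    ext y; simp [cell]
  rw [this]
  exact MeasurableSet.iInter fun j => measurableSet_Ioo.preimage (by fun_prop)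

lemma ae_mem_cell (d : ℕ) : ∀ᵐ y ∂(cellMeasure d), y ∈ cell d :=
  ae_restrict_mem (measurableSet_cell d)

/-- The open cell differs from the half-open cube, a fundamental domain of the lattice, by a null
set. -/
lemma measurePreserving_toTorus (d : ℕ) :
    MeasurePreserving toTorus (cellMeasure d) (torusMeasure d) := by
  have h1 : MeasurePreserving (WithLp.ofLp : RR d → Fin d → ℝ) (cellMeasure d)
      (Measure.pi fun _ => volume.restrict (Set.Ioc (0 : ℝ) (0 + 1))) := by
    have hp : (Measure.pi fun _ : Fin d => (volume : Measure ℝ).restrict (Set.Ioc (0 : ℝ) (0 + 1)))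
        = (volume : Measure (Fin d → ℝ)).restrict (Set.univ.pi fun _ => Set.Ioo (0 : ℝ) 1) := by
      rw [volume_pi, Measure.restrict_pi_pi]
      congr 1
      funext _
      rw [zero_add]
      exact (Measure.restrict_congr_set Ioo_ae_eq_Ioc).symm
    rw [hp]
    have := (PiLp.volume_preserving_ofLp (Fin d)).restrict_preimage
      (s := Set.univ.pi fun _ => Set.Ioo (0 : ℝ) 1)
      (MeasurableSet.univ_pi fun _ => measurableSet_Ioo)
    have hcell : cell d = WithLp.ofLp ⁻¹' (Set.univ.pi fun _ => Set.Ioo (0 : ℝ) 1) := by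
      ext y
      exact ⟨fun h j _ => h j, fun h j => h j trivial⟩
    rw [cellMeasure, hcell]
    exact this
  have h2 : MeasurePreserving (fun (x : Fin d → ℝ) (j : Fin d) => (x j : UnitAddCircle))
      (Measure.pi fun _ => volume.restrict (Set.Ioc (0 : ℝ) (0 + 1))) (torusMeasure d) := by
    refine measurePreserving_pi _ _ fun j => ?_
    have := AddCircle.measurePreserving_mk 1 0
    rwa [AddCircle.volume_eq_smul_haarAddCircle, ENNReal.ofReal_one, one_smul] at this
  exact h2.comp h1

instance (d : ℕ) : IsProbabilityMeasure (cellMeasure d) :=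
  ⟨by
    have := (measurePreserving_toTorus d).measure_preimage MeasurableSet.univ.nullMeasurableSet
    simpa using this⟩

lemma measurePreserving_fromTorus (d : ℕ) :
    MeasurePreserving fromTorus (torusMeasure d) (cellMeasure d) := by
  refine ⟨measurable_fromTorus, ?_⟩
  rw [← (measurePreserving_toTorus d).map_eq, Measure.map_map measurable_fromTorus
    measurable_toTorus]
  conv_rhs => rw [← Measure.map_id (μ := cellMeasure d)]
  refine Measure.map_congr ?_
  filter_upwards [ae_mem_cell d] with y hy
  exact fromTorus_toTorus hy

lemma integral_comp_fromTorus {d : ℕ} {E : Type*} [NormedAddCommGroup E] [NormedSpace ℝ E]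
    {f : RR d → E} (hf : AEStronglyMeasurable f (cellMeasure d)) :
    ∫ x, f (fromTorus x) ∂(torusMeasure d) = ∫ y, f y ∂(cellMeasure d) := by
  rw [← (measurePreserving_fromTorus d).map_eq] at hf ⊢
  exact (integral_map measurable_fromTorus.aemeasurable hf).symm

/-! ### Periodic functions: translation invariance and integration by parts -/

/-- The integral over the cell of a periodic function is invariant under translations. -/
lemma integral_cell_add {d : ℕ} {E : Type*} [NormedAddCommGroup E] [NormedSpace ℝ E]
    {g : RR d → E} (hg : Continuous g) (hper : ∀ (k : Fin d → ℤ) y, g (y + intVec k) = g y)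
    (z : RR d) : ∫ y, g (y + z) ∂(cellMeasure d) = ∫ y, g y ∂(cellMeasure d) := by
  have hG : ∀ y, g (fromTorus (toTorus y)) = g y := fun y => by
    obtain ⟨k, hk⟩ := exists_fromTorus_toTorus y
    rw [hk, hper]
  have hz : Continuous fun y => g (y + z) := hg.comp (continuous_add_const z)
  -- On the torus the translation by `z` becomes a rotation, which preserves Haar measure.
  rw [← integral_comp_fromTorus hg.aestronglyMeasurable,
    ← integral_comp_fromTorus hz.aestronglyMeasurable,
    ← integral_add_right_eq_self (fun x => g (fromTorus x)) (toTorus z)]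
  congr 1
  funext x
  rw [← hG (fromTorus x + z), toTorus_add, toTorus_fromTorus]

lemma isBounded_cell (d : ℕ) : Bornology.IsBounded (cell d) := by
  refine (Metric.isBounded_iff_subset_closedBall 0).2 ⟨d, fun y hy => ?_⟩
  rw [mem_closedBall_zero_iff]
  calc ‖y‖ ≤ ∑ j, ‖EuclideanSpace.single j (y j)‖ := by
        conv_lhs => rw [show y = ∑ j, EuclideanSpace.single j (y j) by
          ext i; simp [Finset.sum_apply, Pi.single_apply]]
        exact norm_sum_le _ _
    _ ≤ ∑ _j : Fin d, (1 : ℝ) := by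
        refine Finset.sum_le_sum fun j _ => ?_
        rw [PiLp.norm_single, Real.norm_eq_abs, abs_of_pos (hy j).1]
        exact (hy j).2.le
    _ = d := by simp

lemma integrable_cell_of_continuous {d : ℕ} {E : Type*} [NormedAddCommGroup E]
    {g : RR d → E} (hg : Continuous g) : Integrable g (cellMeasure d) := by
  obtain ⟨C, hC⟩ := (isBounded_cell d).isCompact_closure.exists_bound_of_continuousOn
    hg.continuousOn
  refine Integrable.of_bound hg.aestronglyMeasurable C ?_
  filter_upwards [ae_mem_cell d] with y hy using hC y (subset_closure hy)

/-- The directional derivatives of a periodic function have mean zero over the cell. -/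
lemma integral_cell_fderiv_eq_zero {d : ℕ} {E : Type*} [NormedAddCommGroup E] [NormedSpace ℝ E]
    {g : RR d → E} (hg : ContDiff ℝ 1 g)
    (hper : ∀ (k : Fin d → ℤ) y, g (y + intVec k) = g y) (z : RR d) :
    ∫ y, fderiv ℝ g y z ∂(cellMeasure d) = 0 := by
  have hc : Continuous fun y => fderiv ℝ g y z :=
    (hg.continuous_fderiv one_ne_zero).clm_apply continuous_const
  obtain ⟨R, hR⟩ := (Metric.isBounded_iff_subset_closedBall 0).1 (isBounded_cell d)
  obtain ⟨C, hC⟩ := (isCompact_closedBall (0 : RR d) (R + ‖z‖)).exists_bound_of_continuousOn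
    hc.continuousOn
  -- Differentiate `t ↦ ∫ g(y + t z) dy` at `0`; by translation invariance this function is
  -- constant. For `|t| < 1` all points `y + t z` lie in the ball of radius `R + ‖z‖`, which
  -- supplies the dominating constant `C`.
  have key := hasDerivAt_integral_of_dominated_loc_of_deriv_le (μ := cellMeasure d) (𝕜 := ℝ)
    (F := fun t y => g (y + t • z)) (F' := fun t y => fderiv ℝ g (y + t • z) z) (x₀ := 0)
    (s := Metric.ball 0 1) (bound := fun _ => C) (Metric.ball_mem_nhds 0 one_pos)
    (Filter.Eventually.of_forall fun t =>
      (hg.continuous.comp (continuous_add_const _)).aestronglyMeasurable)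
    (by simpa using integrable_cell_of_continuous hg.continuous)
    (by simpa using hc.aestronglyMeasurable)
    (by
      filter_upwards [ae_mem_cell d] with y hy t ht
      refine hC _ ?_
      rw [mem_closedBall_zero_iff]
      have h1 := mem_closedBall_zero_iff.1 (hR hy)
      rw [mem_ball_zero_iff] at ht
      calc ‖y + t • z‖ ≤ ‖y‖ + ‖t‖ * ‖z‖ := by rw [← norm_smul]; exact norm_add_le _ _
        _ ≤ R + ‖z‖ := by nlinarith [norm_nonneg z])
    (integrable_const _)
    (by
      refine Filter.Eventually.of_forall fun y t _ => ?_
      have h1 : HasDerivAt (fun t : ℝ => y + t • z) z t := by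
        simpa using ((hasDerivAt_id t).smul_const z).const_add y
      exact ((hg.differentiable one_ne_zero _).hasFDerivAt.comp_hasDerivAt t h1))
  have h2 := key.2
  simp only [integral_cell_add hg.continuous hper, zero_smul, add_zero] at h2
  exact h2.unique (hasDerivAt_const _ _)

/-! ### Plane waves and Parseval's identity -/

lemma planeWave_zero_left {d : ℕ} (y : RR d) : planeWave 0 y = 1 := by simp [planeWave]

lemma planeWave_add_left {d : ℕ} (θ η y : RR d) :
    planeWave (θ + η) y = planeWave θ y * planeWave η y := by
  simp [planeWave, inner_add_left, mul_add, Complex.exp_add]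

lemma planeWave_add_right {d : ℕ} (θ y z : RR d) :
    planeWave θ (y + z) = planeWave θ y * planeWave θ z := by
  simp [planeWave, inner_add_right, mul_add, Complex.exp_add]

lemma planeWave_neg_mul {d : ℕ} (θ y : RR d) : planeWave (-θ) y * planeWave θ y = 1 := by
  rw [← planeWave_add_left, neg_add_cancel, planeWave_zero_left]

lemma conj_planeWave {d : ℕ} (θ y : RR d) :
    (starRingEnd ℂ) (planeWave θ y) = planeWave (-θ) y := by
  simp [planeWave, ← Complex.exp_conj]

lemma norm_planeWave {d : ℕ} (θ y : RR d) : ‖planeWave θ y‖ = 1 := by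
  rw [planeWave, mul_comm]; exact Complex.norm_exp_ofReal_mul_I _

lemma hasFDerivAt_planeWave {d : ℕ} (θ y : RR d) :
    HasFDerivAt (planeWave θ)
      (planeWave θ y • (Complex.I • (Complex.ofRealCLM.comp (innerSL ℝ θ)))) y := by
  have h : HasFDerivAt (fun y : RR d => Complex.I * ((inner ℝ θ y : ℝ) : ℂ))
      (Complex.I • (Complex.ofRealCLM.comp (innerSL ℝ θ))) y :=
    (Complex.ofRealCLM.comp (innerSL ℝ θ)).hasFDerivAt.const_mul Complex.I
  exact h.cexp

lemma contDiff_planeWave {d : ℕ} (θ : RR d) {m : WithTop ℕ∞} : ContDiff ℝ m (planeWave θ) := by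
  have h : ContDiff ℝ m fun y : RR d => Complex.I * ((inner ℝ θ y : ℝ) : ℂ) :=
    contDiff_const.mul ((Complex.ofRealCLM.comp (innerSL ℝ θ)).contDiff)
  exact h.cexp

lemma continuous_planeWave {d : ℕ} (θ : RR d) : Continuous (planeWave θ) :=
  (contDiff_planeWave (m := 0) θ).continuous

/-- The frequency `2πk` of the dual lattice. -/
def freq {d : ℕ} (k : Fin d → ℤ) : RR d := (2 * Real.pi) • intVec k

lemma inner_freq_intVec {d : ℕ} (k m : Fin d → ℤ) :
    inner ℝ (freq k) (intVec m) = ((∑ j, k j * m j : ℤ) : ℝ) * (2 * Real.pi) := by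
  rw [freq, real_inner_smul_left, mul_comm]
  congr 1
  simp [intVec, PiLp.inner_apply, mul_comm]

lemma planeWave_freq_intVec {d : ℕ} (k m : Fin d → ℤ) : planeWave (freq k) (intVec m) = 1 := by
  rw [planeWave, inner_freq_intVec, Complex.exp_eq_one_iff]
  exact ⟨∑ j, k j * m j, by push_cast; ring⟩

lemma mFourier_toTorus {d : ℕ} (k : Fin d → ℤ) (y : RR d) :
    UnitAddTorus.mFourier k (toTorus y) = planeWave (freq k) y := by
  simp only [UnitAddTorus.mFourier, ContinuousMap.coe_mk, toTorus, fourier_coe_apply, planeWave,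
    freq, ← Complex.exp_sum]
  congr 1
  simp only [PiLp.inner_apply, intVec, PiLp.smul_apply]
  push_cast
  rw [Finset.mul_sum]
  refine Finset.sum_congr rfl fun j _ => ?_
  simp
  ring

/-- Parseval's identity on the cell. -/
lemma hasSum_sq_fourier_cell {d : ℕ} {f : RR d → ℂ} (hf : MemLp f 2 (cellMeasure d)) :
    HasSum (fun k : Fin d → ℤ => ‖∫ y, planeWave (-freq k) y * f y ∂(cellMeasure d)‖ ^ 2)
      (∫ y, ‖f y‖ ^ 2 ∂(cellMeasure d)) := by
  have hF : MemLp (fun x => f (fromTorus x)) 2 (torusMeasure d) :=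
    hf.comp_measurePreserving (measurePreserving_fromTorus d)
  have key := UnitAddTorus.hasSum_sq_mFourierCoeff (d := Fin d) (MemLp.toLp _ hF)
  have h1 : ∀ k, UnitAddTorus.mFourierCoeff (MemLp.toLp _ hF) k
      = ∫ y, planeWave (-freq k) y * f y ∂(cellMeasure d) := fun k => by
    rw [← integral_comp_fromTorus
      (f := fun y => planeWave (-freq k) y * f y)
      ((continuous_planeWave _).aestronglyMeasurable.mul hf.1)]
    refine integral_congr_ae ?_
    filter_upwards [hF.coeFn_toLp] with x hx
    rw [hx, smul_eq_mul, UnitAddTorus.mFourier_neg]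
    conv_lhs => rw [← toTorus_fromTorus x, mFourier_toTorus, conj_planeWave, toTorus_fromTorus]
  have h2 : ∫ x, ‖(MemLp.toLp _ hF) x‖ ^ 2 ∂(torusMeasure d)
      = ∫ y, ‖f y‖ ^ 2 ∂(cellMeasure d) := by
    rw [← integral_comp_fromTorus (f := fun y => ‖f y‖ ^ 2) (hf.1.norm.pow 2)]
    refine integral_congr_ae ?_
    filter_upwards [hF.coeFn_toLp] with x hx
    rw [hx]
  rw [← h2, ← funext fun k => congrArg (fun z : ℂ => ‖z‖ ^ 2) (h1 k)]
  exact key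

section Waves

variable {d : ℕ} {ι : Type*} [Fintype ι]

lemma memLp_planeWave_smul (ξ : RR d) (x : EuclideanSpace ℂ ι) :
    MemLp (fun y => planeWave ξ y • x) 2 (cellMeasure d) :=
  MemLp.of_bound ((continuous_planeWave ξ).smul continuous_const).aestronglyMeasurable ‖x‖
    (Filter.Eventually.of_forall fun y => by rw [norm_smul, norm_planeWave, one_mul])

/-- The vector-valued plane wave `y ↦ e^{i⟨ξ,y⟩} x` in `L²(Y)`. -/
def wave (ξ : RR d) (x : EuclideanSpace ℂ ι) : Lp (EuclideanSpace ℂ ι) 2 (cellMeasure d) :=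
  (memLp_planeWave_smul ξ x).toLp _

lemma coeFn_wave (ξ : RR d) (x : EuclideanSpace ℂ ι) :
    wave ξ x =ᵐ[cellMeasure d] fun y => planeWave ξ y • x :=
  MemLp.coeFn_toLp _

lemma inner_wave_single [DecidableEq ι] (ξ : RR d) (i : ι)
    (u : Lp (EuclideanSpace ℂ ι) 2 (cellMeasure d)) :
    inner ℂ (wave ξ (EuclideanSpace.single i (1 : ℂ))) u
      = ∫ y, planeWave (-ξ) y * u y i ∂(cellMeasure d) := by
  rw [L2.inner_def]
  refine integral_congr_ae ?_
  filter_upwards [coeFn_wave ξ (EuclideanSpace.single i (1 : ℂ))] with y hy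
  rw [hy, inner_smul_left, EuclideanSpace.inner_single_left, map_one, one_mul, conj_planeWave]

lemma Lp_norm_sq_eq_integral {E : Type*} [NormedAddCommGroup E] [InnerProductSpace ℂ E]
    {α : Type*} [MeasurableSpace α] {μ : Measure α} (u : Lp E 2 μ) :
    ‖u‖ ^ 2 = ∫ y, ‖u y‖ ^ 2 ∂μ := by
  have h : (inner ℂ u u : ℂ) = ((∫ y, ‖u y‖ ^ 2 ∂μ : ℝ) : ℂ) := by
    rw [L2.inner_def, ← integral_complex_ofReal]
    simp [inner_self_eq_norm_sq_to_K]
  rw [@norm_sq_eq_re_inner ℂ, h]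
  rfl

/-- Parseval's identity for the quasi-periodic plane waves. -/
lemma hasSum_sq_inner_wave [DecidableEq ι] (θ : RR d)
    (u : Lp (EuclideanSpace ℂ ι) 2 (cellMeasure d)) :
    HasSum (fun k : Fin d → ℤ =>
      ∑ i, ‖inner ℂ (wave (θ + freq k) (EuclideanSpace.single i (1 : ℂ))) u‖ ^ 2) (‖u‖ ^ 2) := by
  have hu : ∀ i, MemLp (fun y => u y i) 2 (cellMeasure d) := fun i =>
    (EuclideanSpace.proj (𝕜 := ℂ) i).comp_memLp' (Lp.memLp u)
  have hn : ∀ i y, ‖planeWave (-θ) y * u y i‖ = ‖u y i‖ := fun i y => by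
    rw [norm_mul, norm_planeWave, one_mul]
  -- Removing the unimodular factor `e^{iθ·y}` reduces the claim to ordinary Fourier series,
  -- componentwise.
  have hf : ∀ i, MemLp (fun y => planeWave (-θ) y * u y i) 2 (cellMeasure d) := fun i =>
    (hu i).of_le ((continuous_planeWave _).aestronglyMeasurable.mul (hu i).1)
      (Filter.Eventually.of_forall fun y => (hn i y).le)
  have key := hasSum_sum fun i (_ : i ∈ Finset.univ) => hasSum_sq_fourier_cell (hf i)
  convert key using 1
  · funext k
    refine Finset.sum_congr rfl fun i _ => ?_
    rw [inner_wave_single]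
    congr 3
    funext y
    rw [neg_add, planeWave_add_left]
    ring
  · rw [Lp_norm_sq_eq_integral, ← integral_finsetSum]
    · refine integral_congr_ae (Filter.Eventually.of_forall fun y => ?_)
      simp only [hn, EuclideanSpace.norm_sq_eq]
    · exact fun i _ => (hf i).integrable_norm_pow two_ne_zero

end Waves

/-! ### Multiplication, modulation and tensor operators on `L²` -/

section MultiplicationOperators

variable {α E F : Type*} [MeasurableSpace α] {μ : Measure α} [NormedAddCommGroup E]
  [NormedSpace ℂ E] [NormedAddCommGroup F] [NormedSpace ℂ F]

/-- Multiplication by an essentially bounded operator field, as an operator on `L²`. -/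
def mulOp (A : α → E →L[ℂ] F) (hA : MemLp A ⊤ μ) : Lp E 2 μ →L[ℂ] Lp F 2 μ :=
  (ContinuousLinearMap.id ℂ (E →L[ℂ] F)).holderL μ ⊤ 2 2 (hA.toLp A)

lemma coeFn_mulOp (A : α → E →L[ℂ] F) (hA : MemLp A ⊤ μ) (u : Lp E 2 μ) :
    mulOp A hA u =ᵐ[μ] fun y => A y (u y) := by
  filter_upwards [(ContinuousLinearMap.id ℂ (E →L[ℂ] F)).coeFn_holder (r := 2) (hA.toLp A) u,
    hA.coeFn_toLp] with y h1 h2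
  refine h1.trans ?_
  rw [h2]
  rfl

end MultiplicationOperators

section Modulation

variable {d : ℕ} {E : Type*} [NormedAddCommGroup E] [NormedSpace ℂ E]

lemma memLp_planeWave_id (θ : RR d) :
    MemLp (fun y => planeWave θ y • ContinuousLinearMap.id ℂ E) ⊤ (cellMeasure d) :=
  MemLp.of_bound ((continuous_planeWave θ).smul continuous_const).aestronglyMeasurable
    ‖ContinuousLinearMap.id ℂ E‖
    (Filter.Eventually.of_forall fun y => by rw [norm_smul, norm_planeWave, one_mul])

/-- Multiplication by the plane wave `e^{i⟨θ,y⟩}` on `L²(Y)`. -/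
def modulate (θ : RR d) : Lp E 2 (cellMeasure d) →L[ℂ] Lp E 2 (cellMeasure d) :=
  mulOp _ (memLp_planeWave_id θ)

lemma coeFn_modulate (θ : RR d) (u : Lp E 2 (cellMeasure d)) :
    modulate θ u =ᵐ[cellMeasure d] fun y => planeWave θ y • u y := by
  filter_upwards [coeFn_mulOp _ (memLp_planeWave_id θ) u] with y hy
  rw [modulate, hy]
  rfl

lemma modulate_neg_modulate (θ : RR d) (u : Lp E 2 (cellMeasure d)) :
    modulate (-θ) (modulate θ u) = u := by
  refine Lp.ext ?_
  filter_upwards [coeFn_modulate (-θ) (modulate θ u), coeFn_modulate θ u] with y h1 h2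
  rw [h1, h2, smul_smul, planeWave_neg_mul, one_smul]

lemma norm_modulate (θ : RR d) (u : Lp E 2 (cellMeasure d)) : ‖modulate θ u‖ = ‖u‖ := by
  rw [Lp.norm_def, Lp.norm_def]
  congr 1
  refine eLpNorm_congr_norm_ae ?_
  filter_upwards [coeFn_modulate θ u] with y hy
  rw [hy, norm_smul, norm_planeWave, one_mul]

end Modulation

lemma inner_modulate {d : ℕ} {E : Type*} [NormedAddCommGroup E] [InnerProductSpace ℂ E]
    (θ : RR d) (u v : Lp E 2 (cellMeasure d)) :
    inner ℂ (modulate θ u) v = inner ℂ u (modulate (-θ) v) := by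
  rw [L2.inner_def, L2.inner_def]
  refine integral_congr_ae ?_
  filter_upwards [coeFn_modulate θ u, coeFn_modulate (-θ) v] with y h1 h2
  rw [h1, h2, inner_smul_left, inner_smul_right, conj_planeWave]

lemma modulate_wave {d : ℕ} {ι : Type*} [Fintype ι] (θ ξ : RR d) (x : EuclideanSpace ℂ ι) :
    modulate θ (wave ξ x) = wave (θ + ξ) x := by
  refine Lp.ext ?_
  filter_upwards [coeFn_modulate θ (wave ξ x), coeFn_wave ξ x, coeFn_wave (θ + ξ) x]
    with y h1 h2 h3
  rw [h1, h2, h3, smul_smul, planeWave_add_left]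

section Tensor

variable {n d : ℕ}

/-- The map `x ↦ i x ⊗ θ` from `ℂ^n` to `ℂ^{n×d}`. -/
def tensorI (n : ℕ) (θ : RR d) : CVec n →L[ℂ] CMat n d :=
  LinearMap.toContinuousLinearMap
    { toFun := fun x => WithLp.toLp 2 fun ij => Complex.I * θ ij.2 * x ij.1
      map_add' := fun x y => by ext ij; simp [mul_add]
      map_smul' := fun c x => by ext ij; simp; ring }

lemma tensorI_apply (θ : RR d) (x : CVec n) (ij : Fin n × Fin d) :
    tensorI n θ x ij = Complex.I * θ ij.2 * x ij.1 := rfl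

lemma norm_tensorI_le (θ : RR d) : ‖tensorI n θ‖ ≤ ‖θ‖ := by
  refine ContinuousLinearMap.opNorm_le_bound _ (norm_nonneg _) fun x => ?_
  refine le_of_eq ?_
  rw [← sq_eq_sq₀ (norm_nonneg _) (by positivity), mul_pow, EuclideanSpace.norm_sq_eq,
    EuclideanSpace.norm_sq_eq, EuclideanSpace.norm_sq_eq, Finset.sum_mul_sum,
    Fintype.sum_prod_type_right]
  simp [tensorI_apply, mul_pow]

/-- The map `u ↦ i u ⊗ θ` from `[L²(Y)]^n` to `[L²(Y)]^{n×d}`. -/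
def tensorOp (n : ℕ) (θ : RR d) : L2Vec n d →L[ℂ] L2Mat n d :=
  (tensorI n θ).compLpL 2 (cellMeasure d)

lemma coeFn_tensorOp (θ : RR d) (u : L2Vec n d) :
    tensorOp n θ u =ᵐ[cellMeasure d] fun y => tensorI n θ (u y) :=
  (tensorI n θ).coeFn_compLpL u

lemma norm_tensorOp_le (θ : RR d) (u : L2Vec n d) : ‖tensorOp n θ u‖ ≤ ‖θ‖ * ‖u‖ :=
  ((tensorI n θ).norm_compLp_le u).trans
    (mul_le_mul_of_nonneg_right (norm_tensorI_le θ) (norm_nonneg _))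

lemma tensorOp_neg (θ : RR d) (u : L2Vec n d) : tensorOp n (-θ) u = -tensorOp n θ u := by
  refine Lp.ext ?_
  filter_upwards [coeFn_tensorOp (-θ) u, coeFn_tensorOp θ u, Lp.coeFn_neg (tensorOp n θ u)]
    with y h1 h2 h3
  rw [h1, h3, Pi.neg_apply, h2]
  ext ij
  simp [tensorI_apply]

end Tensor

/-! ### Gauge transformation, Fourier coefficients of gradients, Poincaré inequality -/

section Smooth

variable {n d : ℕ}

lemma classicalGrad_apply (φ : RR d → CVec n) (y : RR d) (ij : Fin n × Fin d) :
    classicalGrad φ y ij = fderiv ℝ φ y (EuclideanSpace.single ij.2 1) ij.1 := rfl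

lemma IsSmoothQuasiPeriodic.differentiableAt {θ : RR d} {φ : RR d → CVec n}
    (h : IsSmoothQuasiPeriodic θ φ) (y : RR d) : DifferentiableAt ℝ φ y :=
  (h.contDiff.differentiable (by simp)) y

/-- `[C^∞_θ(Y)]^n` with the gradient, as a subspace of `[L²(Y)]^n × [L²(Y)]^{n×d}`. -/
def smoothSubmodule (n : ℕ) {d : ℕ} (θ : RR d) : Submodule ℂ (L2Vec n d × L2Mat n d) where
  carrier := smoothGraph n θ
  zero_mem' := by
    refine ⟨0, ⟨contDiff_const, fun k y => by simp⟩, Lp.coeFn_zero _ _ _, ?_⟩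
    refine (Lp.coeFn_zero _ _ _).trans (Filter.Eventually.of_forall fun y => ?_)
    ext ij
    simp [classicalGrad_apply]
  add_mem' := by
    rintro v w ⟨φ, hφ, h1, h2⟩ ⟨ψ, hψ, h3, h4⟩
    refine ⟨φ + ψ, ⟨hφ.contDiff.add hψ.contDiff, fun k y => ?_⟩, ?_, ?_⟩
    · simp [hφ.quasiPeriodic, hψ.quasiPeriodic]
    · exact (Lp.coeFn_add _ _).trans (h1.add h3)
    · refine (Lp.coeFn_add _ _).trans ((h2.add h4).trans ?_)
      refine Filter.Eventually.of_forall fun y => ?_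
      ext ij
      simp [classicalGrad_apply, fderiv_add (hφ.differentiableAt y) (hψ.differentiableAt y)]
  smul_mem' := by
    rintro c w ⟨φ, hφ, h1, h2⟩
    refine ⟨c • φ, ⟨contDiff_const.smul hφ.contDiff, fun k y => ?_⟩, ?_, ?_⟩
    · simp [hφ.quasiPeriodic, smul_comm c]
    · exact (Lp.coeFn_smul _ _).trans (h1.const_smul c)
    · refine (Lp.coeFn_smul _ _).trans ((h2.const_smul c).trans ?_)
      refine Filter.Eventually.of_forall fun y => ?_
      ext ij
      simp [classicalGrad_apply, fderiv_const_smul (hφ.differentiableAt y)]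

lemma fderiv_planeWave_smul (θ : RR d) {φ : RR d → CVec n} {y : RR d}
    (h : DifferentiableAt ℝ φ y) (z : RR d) :
    fderiv ℝ (fun y => planeWave θ y • φ y) y z
      = planeWave θ y • (fderiv ℝ φ y z + (Complex.I * (inner ℝ θ z : ℝ)) • φ y) := by
  have h1 : HasFDerivAt (fun y => planeWave θ y • φ y) _ y :=
    (hasFDerivAt_planeWave θ y).smul h.hasFDerivAt
  rw [h1.fderiv]
  simp [smul_smul, mul_assoc]

lemma inner_single_one (θ : RR d) (j : Fin d) :
    inner ℝ θ (EuclideanSpace.single j (1 : ℝ)) = θ j := by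
  rw [EuclideanSpace.inner_single_right]; simp

lemma IsSmoothQuasiPeriodic.planeWave_smul {η : RR d} {φ : RR d → CVec n}
    (h : IsSmoothQuasiPeriodic η φ) (θ : RR d) :
    IsSmoothQuasiPeriodic (θ + η) fun y => planeWave θ y • φ y where
  contDiff := (contDiff_planeWave θ).smul h.contDiff
  quasiPeriodic k y := by
    rw [h.quasiPeriodic, planeWave_add_right, planeWave_add_left, smul_smul, smul_smul]
    ring_nf

/-- Multiplication by `e^{i⟨θ,y⟩}` on pairs of a function and its gradient. -/
def gaugeShift (n : ℕ) (θ : RR d) : (L2Vec n d × L2Mat n d) →L[ℂ] (L2Vec n d × L2Mat n d) :=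
  ((modulate θ).comp (ContinuousLinearMap.fst ℂ _ _)).prod
    ((modulate θ).comp
      (ContinuousLinearMap.snd ℂ _ _ + (tensorOp n θ).comp (ContinuousLinearMap.fst ℂ _ _)))

lemma gaugeShift_fst (θ : RR d) (w : L2Vec n d × L2Mat n d) :
    (gaugeShift n θ w).1 = modulate θ w.1 := rfl

lemma gaugeShift_snd (θ : RR d) (w : L2Vec n d × L2Mat n d) :
    (gaugeShift n θ w).2 = modulate θ (w.2 + tensorOp n θ w.1) := rfl

/-- The product rule `∇(e^{iθ·y} φ) = e^{iθ·y}(∇φ + i φ ⊗ θ)`; the quasi-momenta of the two factors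
add up. -/
lemma gaugeShift_mem_smoothGraph (θ : RR d) {η : RR d} {w : L2Vec n d × L2Mat n d}
    (hw : w ∈ smoothGraph n η) : gaugeShift n θ w ∈ smoothGraph n (θ + η) := by
  obtain ⟨φ, hφ, h1, h2⟩ := hw
  refine ⟨_, hφ.planeWave_smul θ, ?_, ?_⟩
  · filter_upwards [coeFn_modulate θ w.1, h1] with y h3 h4
    rw [gaugeShift_fst, h3, h4]
  · filter_upwards [coeFn_modulate θ (w.2 + tensorOp n θ w.1), h1, h2,
      Lp.coeFn_add w.2 (tensorOp n θ w.1), coeFn_tensorOp θ w.1] with y h3 h4 h5 h6 h7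
    rw [gaugeShift_snd, h3, h6, Pi.add_apply, h7, h4, h5]
    ext ij
    rw [classicalGrad_apply, fderiv_planeWave_smul θ (hφ.differentiableAt y), inner_single_one]
    simp [classicalGrad_apply, tensorI_apply]

lemma gaugeShift_mem_H1 (θ : RR d) {η : RR d} {w : L2Vec n d × L2Mat n d}
    (hw : w ∈ H1 n η) : gaugeShift n θ w ∈ H1 n (θ + η) :=
  map_mem_closure (gaugeShift n θ).continuous hw fun _ => gaugeShift_mem_smoothGraph θ

/-- With `ξ = θ + 2πk`, the function `e^{-iξ·y} φ` is periodic, so its partial derivatives have mean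
zero; the product rule turns this into the formula. -/
lemma fourier_grad_of_mem_smoothGraph {θ : RR d} {w : L2Vec n d × L2Mat n d}
    (hw : w ∈ smoothGraph n θ) (k : Fin d → ℤ) (ij : Fin n × Fin d) :
    inner ℂ (wave (θ + freq k) (EuclideanSpace.single ij (1 : ℂ))) w.2
      = Complex.I * (θ + freq k) ij.2 *
        inner ℂ (wave (θ + freq k) (EuclideanSpace.single ij.1 (1 : ℂ))) w.1 := by
  obtain ⟨φ, hφ, h1, h2⟩ := hw
  set ξ := θ + freq k with hξ
  set z : RR d := EuclideanSpace.single ij.2 1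
  have hper : ∀ (m : Fin d → ℤ) y,
      planeWave (-ξ) (y + intVec m) • φ (y + intVec m) = planeWave (-ξ) y • φ y := fun m y => by
    have hm : planeWave (-ξ) (intVec m) * planeWave θ (intVec m) = 1 := by
      have h := planeWave_neg_mul ξ (intVec m)
      rwa [hξ, planeWave_add_left θ (freq k), planeWave_freq_intVec, mul_one] at h
    rw [hφ.quasiPeriodic, planeWave_add_right, smul_smul, mul_assoc, hm, mul_one]
  have hsm : ContDiff ℝ 1 φ := hφ.contDiff.of_le (by exact_mod_cast le_top)
  have hG : ContDiff ℝ 1 fun y => planeWave (-ξ) y • φ y := (contDiff_planeWave (-ξ)).smul hsm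
  have hz : Continuous fun y => fderiv ℝ φ y z :=
    (hsm.continuous_fderiv one_ne_zero).clm_apply continuous_const
  have hcs : ∀ c : ℂ, Continuous fun y => c • φ y :=
    fun c => by have := hsm.continuous; fun_prop
  have key := integral_cell_fderiv_eq_zero hG hper z
  simp only [fun y => fderiv_planeWave_smul (-ξ) (hφ.differentiableAt y) z] at key
  have hint : Integrable (fun y => planeWave (-ξ) y •
      (fderiv ℝ φ y z + (Complex.I * (inner ℝ (-ξ) z : ℝ)) • φ y)) (cellMeasure d) :=
    integrable_cell_of_continuous
      ((continuous_planeWave _).smul (hz.add (hcs _)))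
  have hi : ∫ y, (planeWave (-ξ) y * fderiv ℝ φ y z ij.1
      - Complex.I * ξ ij.2 * (planeWave (-ξ) y * φ y ij.1)) ∂(cellMeasure d) = 0 := by
    have h3 := (EuclideanSpace.proj ij.1 : CVec n →L[ℂ] ℂ).integral_comp_comm hint
    rw [key, map_zero] at h3
    rw [← h3]
    refine integral_congr_ae (Filter.Eventually.of_forall fun y => ?_)
    simp only [inner_neg_left, inner_single_one, z, PiLp.proj_apply, PiLp.smul_apply,
      PiLp.add_apply, smul_eq_mul]
    push_cast
    ring
  have hc1 : Continuous fun y => planeWave (-ξ) y * fderiv ℝ φ y z ij.1 :=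
    (continuous_planeWave _).mul ((EuclideanSpace.proj (𝕜 := ℂ) ij.1).continuous.comp hz)
  have hc2 : Continuous fun y => planeWave (-ξ) y * φ y ij.1 :=
    (continuous_planeWave _).mul
      ((EuclideanSpace.proj (𝕜 := ℂ) ij.1).continuous.comp hsm.continuous)
  rw [integral_sub (integrable_cell_of_continuous hc1)
    ((integrable_cell_of_continuous hc2).const_mul _), integral_const_mul, sub_eq_zero] at hi
  rw [inner_wave_single, inner_wave_single]
  convert hi using 1
  · refine integral_congr_ae ?_
    filter_upwards [h2] with y hy
    rw [hy, classicalGrad_apply]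
  · congr 1
    refine integral_congr_ae ?_
    filter_upwards [h1] with y hy
    rw [hy]

/-- The Fourier coefficients of the gradient of a function in `[H^1_θ(Y)]^n`. -/
lemma fourier_grad {θ : RR d} {w : L2Vec n d × L2Mat n d}
    (hw : w ∈ H1 n θ) (k : Fin d → ℤ) (ij : Fin n × Fin d) :
    inner ℂ (wave (θ + freq k) (EuclideanSpace.single ij (1 : ℂ))) w.2
      = Complex.I * (θ + freq k) ij.2 *
        inner ℂ (wave (θ + freq k) (EuclideanSpace.single ij.1 (1 : ℂ))) w.1 := by
  refine closure_minimal (t := {w : L2Vec n d × L2Mat n d |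
    inner ℂ (wave (θ + freq k) (EuclideanSpace.single ij (1 : ℂ))) w.2
      = Complex.I * (θ + freq k) ij.2 *
        inner ℂ (wave (θ + freq k) (EuclideanSpace.single ij.1 (1 : ℂ))) w.1})
    (fun w hw => fourier_grad_of_mem_smoothGraph hw k ij) ?_ hw
  -- Both sides are continuous in the graph norm, so the identity passes from smooth functions to
  -- limits.
  exact isClosed_eq (continuous_const.inner continuous_snd)
    (continuous_const.mul (continuous_const.inner continuous_fst))

lemma freq_apply (k : Fin d → ℤ) (j : Fin d) : freq k j = 2 * Real.pi * k j := rfl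

/-- A nonzero multiple of `2π` cannot be moved closer than `π` to the origin by `θ_j ∈ [-π,π)`. Here
the restriction to `Θ` enters, and the Poincaré constant is born. -/
lemma pi_le_abs_add_freq {θ : RR d} (hθ : θ ∈ Theta d) {k : Fin d → ℤ} {j : Fin d}
    (hj : k j ≠ 0) : Real.pi ≤ |(θ + freq k) j| := by
  have h := hθ j
  have hpi := Real.pi_pos
  rw [PiLp.add_apply, freq_apply, le_abs]
  rcases lt_or_gt_of_ne hj with h0 | h0
  · right
    have : (k j : ℝ) ≤ -1 := by exact_mod_cast Int.le_sub_one_of_lt h0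
    nlinarith [h.2]
  · left
    have : (1 : ℝ) ≤ k j := by exact_mod_cast h0
    nlinarith [h.1]

lemma inner_wave_eq_zero {θ : RR d} {w : L2Vec n d × L2Mat n d} (hw : w ∈ H1perp n θ)
    (i : Fin n) : inner ℂ (wave θ (EuclideanSpace.single i (1 : ℂ))) w.1 = 0 := by
  rw [inner_wave_single, ← hw.2 i]
  refine integral_congr_ae (Filter.Eventually.of_forall fun y => ?_)
  simp only [conj_planeWave, mul_comm]

/-- The Poincaré inequality on `[H^1_θ(Y) ⊥ e^{i⟨θ,·⟩}]^n`, uniform in `θ ∈ Θ`. -/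
theorem pi_mul_norm_le {θ : RR d} (hθ : θ ∈ Theta d) {w : L2Vec n d × L2Mat n d}
    (hw : w ∈ H1perp n θ) : Real.pi * ‖w.1‖ ≤ ‖w.2‖ := by
  rw [← sq_le_sq₀ (by positivity) (norm_nonneg _), mul_pow]
  -- The two Parseval series are compared mode by mode: the zero mode of `w.1` vanishes, and for `k
  -- ≠ 0` one coordinate `j` with `k j ≠ 0` suffices.
  refine hasSum_le (fun k => ?_) ((hasSum_sq_inner_wave θ w.1).mul_left _)
    (hasSum_sq_inner_wave θ w.2)
  simp only [fourier_grad hw.1]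
  rw [Fintype.sum_prod_type, Finset.mul_sum]
  refine Finset.sum_le_sum fun i _ => ?_
  by_cases hk : k = 0
  · subst hk
    have h0 : freq (0 : Fin d → ℤ) = 0 := by ext j; simp [freq_apply]
    simp [h0, inner_wave_eq_zero hw]
  · obtain ⟨j, hj⟩ := Function.ne_iff.1 hk
    refine le_trans ?_ (Finset.single_le_sum (fun j _ => by positivity) (Finset.mem_univ j))
    rw [norm_mul, mul_pow, norm_mul, Complex.norm_I, one_mul, Complex.norm_real,
      Real.norm_eq_abs]
    gcongr
    exact pi_le_abs_add_freq hθ hj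

end Smooth

/-! ### Abstract coercive problems -/

/-- The Lax–Milgram lemma on a complete subspace of a complex Hilbert space. -/
theorem exists_forall_inner_add_eq_zero {H : Type*} [NormedAddCommGroup H]
    [InnerProductSpace ℂ H] (S : Submodule ℂ H) [CompleteSpace S] (A : H →L[ℂ] H) {ν : ℝ}
    (hν : 0 < ν) (hA : ∀ x, ν * ‖x‖ ^ 2 ≤ (inner ℂ x (A x)).re) (f : H) :
    ∃ x ∈ S, ∀ y ∈ S, inner ℂ y (A x + f) = 0 := by
  let T : S →L[ℂ] S := S.orthogonalProjectionOnto ∘L A ∘L S.subtypeL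
  have hT : ∀ x y : S, inner ℂ y (T x) = inner ℂ (y : H) (A x) := fun x y =>
    S.inner_orthogonalProjectionOnto_eq_of_mem_left y (A x)
  have hT' : ∀ x : S, ν * ‖x‖ ^ 2 ≤ (inner ℂ x (T x)).re := fun x => by
    rw [hT]; exact hA x
  -- Coercivity bounds `T` from below, hence its range is closed; a vector `y` orthogonal to the
  -- range satisfies `⟨y, T y⟩ = 0`, hence vanishes.
  have hbound : ∀ x : S, ‖x‖ ≤ (Real.toNNReal ν⁻¹ : ℝ) * ‖T x‖ := fun x => by
    rw [Real.coe_toNNReal _ (inv_nonneg.2 hν.le)]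
    rcases eq_or_ne x 0 with rfl | hx
    · simp
    have hx0 : 0 < ‖x‖ := norm_pos_iff.2 hx
    have h1 : (inner ℂ x (T x)).re ≤ ‖x‖ * ‖T x‖ :=
      (Complex.re_le_norm _).trans (norm_inner_le_norm _ _)
    rw [inv_mul_eq_div, le_div_iff₀ hν]
    have h2 := hT' x
    nlinarith
  have hclosed : IsClosed (LinearMap.range T.toLinearMap : Set S) := by
    rw [LinearMap.coe_range]
    exact (T.antilipschitz_of_bound hbound).isClosed_range T.uniformContinuous
  have htop : LinearMap.range T.toLinearMap = ⊤ := by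
    have : CompleteSpace (LinearMap.range T.toLinearMap) := hclosed.completeSpace_coe
    rw [← Submodule.orthogonal_eq_bot_iff, Submodule.eq_bot_iff]
    intro y hy
    have h1 : inner ℂ (T y) y = 0 := (Submodule.mem_orthogonal _ y).1 hy (T y) ⟨y, rfl⟩
    have h2 := hT' y
    rw [← inner_conj_symm, h1] at h2
    simp only [map_zero, Complex.zero_re] at h2
    have h3 : ‖y‖ ^ 2 = 0 := le_antisymm (by nlinarith [sq_nonneg ‖y‖]) (sq_nonneg _)
    simpa using h3
  obtain ⟨x, hx⟩ : ∃ x, T x = -S.orthogonalProjectionOnto f := by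
    have : -S.orthogonalProjectionOnto f ∈ LinearMap.range T.toLinearMap := htop ▸ Submodule.mem_top
    exact this
  refine ⟨x, x.2, fun y hy => ?_⟩
  have h1 : inner ℂ (⟨y, hy⟩ : S) (T x + S.orthogonalProjectionOnto f) = 0 := by
    rw [hx, neg_add_cancel, inner_zero_right]
  rw [inner_add_right, hT, S.inner_orthogonalProjectionOnto_eq_of_mem_left] at h1
  rw [inner_add_right]
  exact h1

/-- The energy estimate comparing two coercive variational problems. -/
lemma mul_norm_le_of_inner_eq_zero {H : Type*} [NormedAddCommGroup H]
    [InnerProductSpace ℂ H] (A : H →L[ℂ] H) {ν c : ℝ} (hc : 0 ≤ c)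
    (hA : ∀ x, ν * ‖x‖ ^ 2 ≤ (inner ℂ x (A x)).re) {x t g s : H}
    (h1 : inner ℂ x (A (x + s + g)) = 0) (h2 : inner ℂ (x - t) (A g) = 0)
    (ht : ‖t‖ ≤ c * ‖x‖) : ν * ‖x‖ ≤ ‖A‖ * (c * ‖g‖ + ‖s‖) := by
  rcases eq_or_ne x 0 with rfl | hx
  · rw [norm_zero, mul_zero]
    positivity
  have hx0 : 0 < ‖x‖ := norm_pos_iff.2 hx
  -- The large term `⟨x, A g⟩` occurs in both equations and cancels, leaving only terms in the
  -- perturbations `s` and `t`.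
  have h3 : inner ℂ x (A x) = -inner ℂ x (A s) - inner ℂ t (A g) := by
    rw [map_add, map_add, inner_add_right, inner_add_right] at h1
    rw [inner_sub_left] at h2
    linear_combination h1 - h2
  have h4 : (inner ℂ x (A x)).re ≤ ‖x‖ * (‖A‖ * ‖s‖) + c * ‖x‖ * (‖A‖ * ‖g‖) := by
    refine (Complex.re_le_norm _).trans ?_
    rw [h3]
    refine (norm_sub_le _ _).trans ?_
    rw [norm_neg]
    refine add_le_add ((norm_inner_le_norm _ _).trans ?_) ((norm_inner_le_norm _ _).trans ?_)
    · exact mul_le_mul_of_nonneg_left (A.le_opNorm s) (norm_nonneg _)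
    · exact mul_le_mul ht (A.le_opNorm g) (norm_nonneg _) ((norm_nonneg t).trans ht)
  have h5 := hA x
  refine le_of_mul_le_mul_right ?_ hx0
  nlinarith

/-! ### The variational space and its gradients -/

variable {n d : ℕ}

/-- `[H^1_θ(Y) ⊥ e^{i⟨θ,·⟩}]^n` as a subspace. -/
def perpSubmodule (n : ℕ) {d : ℕ} (θ : RR d) : Submodule ℂ (L2Vec n d × L2Mat n d) :=
  (smoothSubmodule n θ).topologicalClosure ⊓
    ⨅ i : Fin n, LinearMap.ker (((innerSL ℂ (wave θ (EuclideanSpace.single i (1 : ℂ)))).comp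
      (ContinuousLinearMap.fst ℂ (L2Vec n d) (L2Mat n d))).toLinearMap)

lemma mem_perpSubmodule {θ : RR d} {w : L2Vec n d × L2Mat n d} :
    w ∈ perpSubmodule n θ ↔ w ∈ H1 n θ ∧
      ∀ i, inner ℂ (wave θ (EuclideanSpace.single i (1 : ℂ))) w.1 = 0 := by
  simp only [perpSubmodule, Submodule.mem_inf, Submodule.mem_iInf]
  rfl

lemma mem_perpSubmodule_iff {θ : RR d} {w : L2Vec n d × L2Mat n d} :
    w ∈ perpSubmodule n θ ↔ w ∈ H1perp n θ := by
  rw [mem_perpSubmodule]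
  refine and_congr_right fun _ => forall_congr' fun i => ?_
  rw [inner_wave_single]
  simp only [conj_planeWave, mul_comm]

lemma isClosed_perpSubmodule (θ : RR d) : IsClosed (perpSubmodule n θ : Set (L2Vec n d × L2Mat n d)) := by
  have : (perpSubmodule n θ : Set (L2Vec n d × L2Mat n d)) = H1 n θ ∩
      ⋂ i, {w | inner ℂ (wave θ (EuclideanSpace.single i (1 : ℂ))) w.1 = 0} := by
    ext w
    simp [mem_perpSubmodule]
  rw [this]
  exact isClosed_closure.inter
    (isClosed_iInter fun i => isClosed_eq (continuous_const.inner continuous_fst) continuous_const)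

lemma norm_fst_le {θ : RR d} (hθ : θ ∈ Theta d) {w : L2Vec n d × L2Mat n d}
    (hw : w ∈ perpSubmodule n θ) : ‖w.1‖ ≤ ‖w.2‖ := by
  have h := pi_mul_norm_le hθ (mem_perpSubmodule_iff.1 hw)
  nlinarith [Real.pi_gt_three, norm_nonneg w.1]

/-- The gradients of the functions in `[H^1_θ(Y) ⊥ e^{i⟨θ,·⟩}]^n`. -/
def gradSubmodule (n : ℕ) {d : ℕ} (θ : RR d) : Submodule ℂ (L2Mat n d) :=
  (perpSubmodule n θ).map (LinearMap.snd ℂ (L2Vec n d) (L2Mat n d))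

/-- By Poincaré the gradient alone controls the norm of the pair, so `(u, ∇u) ↦ ∇u` is bounded below
and has closed range. The cell problem can thus be solved in the Hilbert space `L²` of gradients. -/
lemma completeSpace_gradSubmodule {θ : RR d} (hθ : θ ∈ Theta d) :
    CompleteSpace (gradSubmodule n θ) := by
  have : CompleteSpace (perpSubmodule n θ) := (isClosed_perpSubmodule θ).completeSpace_coe
  let f : perpSubmodule n θ →L[ℂ] L2Mat n d :=
    (ContinuousLinearMap.snd ℂ _ _).comp (perpSubmodule n θ).subtypeL
  have hf : ∀ w, ‖w‖ ≤ ((1 : NNReal) : ℝ) * ‖f w‖ := fun w => by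
    rw [NNReal.coe_one, one_mul]
    exact max_le (norm_fst_le hθ w.2) le_rfl
  have hc := (f.antilipschitz_of_bound hf).isClosed_range f.uniformContinuous
  have : (gradSubmodule n θ : Set (L2Mat n d)) = Set.range f := by
    ext v
    simp [gradSubmodule, f]
  exact IsClosed.completeSpace_coe (s := (gradSubmodule n θ : Set (L2Mat n d))) (hs := this ▸ hc)

/-! ### The cell problem and the entries of the homogenised tensor -/

section Coefficient

variable {a : RR d → (CMat n d →L[ℂ] CMat n d)}

lemma IsCoeff.memLp_cell (ha : IsCoeff a) : MemLp a ⊤ (cellMeasure d) :=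
  ha.memLp_top.restrict _

/-- Multiplication by the coefficient `a` on `[L²(Y)]^{n×d}`. -/
def coeffOp (ha : IsCoeff a) : L2Mat n d →L[ℂ] L2Mat n d := mulOp a ha.memLp_cell

lemma coeFn_coeffOp (ha : IsCoeff a) (u : L2Mat n d) :
    coeffOp ha u =ᵐ[cellMeasure d] fun y => a y (u y) :=
  coeFn_mulOp a ha.memLp_cell u

/-- The coefficient acts pointwise and linearly; this is why the gauge transformation leaves it
unchanged. -/
lemma coeffOp_modulate (ha : IsCoeff a) (θ : RR d) (u : L2Mat n d) :
    coeffOp ha (modulate θ u) = modulate θ (coeffOp ha u) := by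
  refine Lp.ext ?_
  filter_upwards [coeFn_coeffOp ha (modulate θ u), coeFn_modulate θ u,
    coeFn_modulate θ (coeffOp ha u), coeFn_coeffOp ha u] with y h1 h2 h3 h4
  rw [h1, h2, h3, h4, map_smul]

lemma exists_coercive_coeffOp (ha : IsCoeff a) :
    ∃ ν : ℝ, 0 < ν ∧ ∀ u, ν * ‖u‖ ^ 2 ≤ (inner ℂ u (coeffOp ha u)).re := by
  obtain ⟨ν, hν, h⟩ := ha.coercive
  refine ⟨ν, hν, fun u => ?_⟩
  have hi : Integrable (fun y => inner ℂ (u y) (coeffOp ha u y)) (cellMeasure d) :=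
    L2.integrable_inner u _
  have hre : (inner ℂ u (coeffOp ha u)).re
      = ∫ y, (inner ℂ (u y) (coeffOp ha u y)).re ∂(cellMeasure d) := by
    rw [L2.inner_def]
    exact (integral_re hi).symm
  rw [hre, Lp_norm_sq_eq_integral, ← integral_const_mul]
  refine integral_mono_ae (((Lp.memLp u).integrable_norm_pow two_ne_zero).const_mul ν) hi.re ?_
  filter_upwards [ae_restrict_of_ae h, coeFn_coeffOp ha u] with y h1 h2
  simp only [h2]
  exact h1 (u y)

lemma inner_coeffOp_eq_integral (ha : IsCoeff a) (θ : RR d) (r : Fin n) (s : Fin d)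
    (v u : L2Mat n d) :
    inner ℂ v (coeffOp ha (u + wave θ (unitMat r s)))
      = ∫ y, inner ℂ (v y) (a y (u y + planeWave θ y • unitMat r s)) ∂(cellMeasure d) := by
  rw [L2.inner_def]
  refine integral_congr_ae ?_
  filter_upwards [coeFn_coeffOp ha (u + wave θ (unitMat r s)), coeFn_wave θ (unitMat r s),
    Lp.coeFn_add u (wave θ (unitMat r s))] with y h1 h2 h3
  rw [h1, h3, Pi.add_apply, h2]

lemma isCellSolution_iff (ha : IsCoeff a) {θ : RR d} {r : Fin n} {s : Fin d}
    {N : L2Vec n d × L2Mat n d} :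
    IsCellSolution a θ r s N ↔ N ∈ perpSubmodule n θ ∧ ∀ φ ∈ perpSubmodule n θ,
      inner ℂ φ.2 (coeffOp ha (N.2 + wave θ (unitMat r s))) = 0 := by
  simp only [IsCellSolution, mem_perpSubmodule_iff, inner_coeffOp_eq_integral]

/-- Unique solvability of the cell problem. -/
theorem existsUnique_isCellSolution (ha : IsCoeff a) {θ : RR d} (hθ : θ ∈ Theta d)
    (r : Fin n) (s : Fin d) : ∃! N, IsCellSolution a θ r s N := by
  obtain ⟨ν, hν, hA⟩ := exists_coercive_coeffOp ha
  have := completeSpace_gradSubmodule (n := n) hθ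
  obtain ⟨_, ⟨N, hN, rfl⟩, h⟩ := exists_forall_inner_add_eq_zero (gradSubmodule n θ) (coeffOp ha)
    hν hA (coeffOp ha (wave θ (unitMat r s)))
  have hsol : IsCellSolution a θ r s N := by
    refine (isCellSolution_iff ha).2 ⟨hN, fun φ hφ => ?_⟩
    rw [map_add]
    exact h φ.2 ⟨φ, hφ, rfl⟩
  refine ⟨N, hsol, fun M hM => ?_⟩
  obtain ⟨hN, hN'⟩ := (isCellSolution_iff ha).1 hsol
  obtain ⟨hM, hM'⟩ := (isCellSolution_iff ha).1 hM
  have hw : M - N ∈ perpSubmodule n θ := sub_mem hM hN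
  have h0 : inner ℂ (M - N).2 (coeffOp ha (M - N).2) = 0 := by
    have h1 := hM' _ hw
    have h2 := hN' _ hw
    rw [map_add, inner_add_right] at h1 h2
    rw [Prod.snd_sub, map_sub, inner_sub_right, ← Prod.snd_sub]
    linear_combination h1 - h2
  have h1 : ‖(M - N).2‖ = 0 := by
    have := hA (M - N).2
    rw [h0, Complex.zero_re] at this
    have h3 : ‖(M - N).2‖ ^ 2 = 0 :=
      le_antisymm (by nlinarith [sq_nonneg ‖(M - N).2‖]) (sq_nonneg _)
    simpa using h3
  -- Equal gradients force equal functions, again by Poincaré.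
  have h2 : ‖(M - N).1‖ = 0 := le_antisymm (h1 ▸ norm_fst_le hθ hw) (norm_nonneg _)
  exact sub_eq_zero.1 (Prod.ext (norm_eq_zero.1 h2) (norm_eq_zero.1 h1))

lemma isCellSolution_cellSolution (ha : IsCoeff a) {θ : RR d} (hθ : θ ∈ Theta d)
    (r : Fin n) (s : Fin d) : IsCellSolution a θ r s (cellSolution a θ r s) :=
  Classical.epsilon_spec (existsUnique_isCellSolution ha hθ r s).exists

lemma clm_apply_eq_sum (L : CMat n d →L[ℂ] CMat n d) (X : CMat n d) (ij : Fin n × Fin d) :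
    L X ij = ∑ k, ∑ l, L (unitMat k l) ij * X (k, l) := by
  have hX : X = ∑ k, ∑ l, X (k, l) • (unitMat k l : CMat n d) := by
    rw [← Fintype.sum_prod_type' (f := fun k l => X (k, l) • (unitMat k l : CMat n d))]
    ext kl
    simp [unitMat, Finset.sum_apply, Pi.single_apply]
  conv_lhs => rw [hX]
  simp [map_sum, mul_comm]

/-- The entries of `a^hom(θ)` as inner products. -/
lemma ahomMatrix_eq_inner (ha : IsCoeff a) (θ : RR d) (ij rs : Fin n × Fin d) :
    ahomMatrix a θ ij rs = inner ℂ (wave θ (unitMat ij.1 ij.2))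
      (coeffOp ha ((cellSolution a θ rs.1 rs.2).2 + wave θ (unitMat rs.1 rs.2))) := by
  set u := (cellSolution a θ rs.1 rs.2).2 with hu
  set X := u + wave θ (unitMat rs.1 rs.2) with hX
  have hint : ∀ k l, Integrable
      (fun y => coeffEntry a ij.1 ij.2 k l y * X y (k, l) * planeWave (-θ) y) (cellMeasure d) := by
    intro k l
    have h1 : MemLp (coeffEntry a ij.1 ij.2 k l) ⊤ (cellMeasure d) :=
      ((EuclideanSpace.proj (𝕜 := ℂ) (ij.1, ij.2)).comp
        (ContinuousLinearMap.apply ℂ (CMat n d) (unitMat k l : CMat n d))).comp_memLp'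
        ha.memLp_cell
    have h2 : MemLp (fun y => X y (k, l)) 2 (cellMeasure d) :=
      (EuclideanSpace.proj (𝕜 := ℂ) (k, l)).comp_memLp' (Lp.memLp X)
    have h3 : MemLp (fun y => coeffEntry a ij.1 ij.2 k l y * X y (k, l)) 2 (cellMeasure d) :=
      h2.mul h1
    have h4 := (h3.integrable (by norm_num)).bdd_mul (c := 1)
      (continuous_planeWave (-θ)).aestronglyMeasurable
      (Filter.Eventually.of_forall fun y => (norm_planeWave _ _).le)
    exact h4.congr (Filter.Eventually.of_forall fun y => mul_comm _ _)
  have hXy : ∀ᵐ y ∂(cellMeasure d), ∀ k l, X y (k, l) = u y (k, l) +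
      planeWave θ y * (if k = rs.1 then 1 else 0) * (if l = rs.2 then 1 else 0) := by
    filter_upwards [Lp.coeFn_add u (wave θ (unitMat rs.1 rs.2)), coeFn_wave θ (unitMat rs.1 rs.2)]
      with y h1 h2 k l
    rw [hX, h1, Pi.add_apply, h2]
    simp only [unitMat, PiLp.add_apply, PiLp.smul_apply, PiLp.single_apply,
      Prod.mk.injEq, smul_eq_mul, mul_assoc, ite_and]
    split_ifs <;> simp
  -- Conjugating the wave in the first slot of the inner product produces the weight `e^{-iθ·y}` of
  -- the definition.
  have hw := inner_wave_single θ ij (coeffOp ha X)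
  rw [show EuclideanSpace.single ij (1 : ℂ) = unitMat ij.1 ij.2 from rfl] at hw
  rw [hw]
  have hR : ∫ y, planeWave (-θ) y * coeffOp ha X y ij ∂(cellMeasure d)
      = ∫ y, ∑ k, ∑ l, coeffEntry a ij.1 ij.2 k l y * X y (k, l) * planeWave (-θ) y
        ∂(cellMeasure d) := by
    refine integral_congr_ae ?_
    filter_upwards [coeFn_coeffOp ha X] with y hy
    rw [hy, clm_apply_eq_sum]
    simp only [Finset.mul_sum]
    refine Finset.sum_congr rfl fun k _ => Finset.sum_congr rfl fun l _ => ?_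
    rw [mul_comm]
    rfl
  rw [hR, integral_finsetSum _ fun k _ => integrable_finsetSum _ fun l _ => hint k l, ahomMatrix]
  refine Finset.sum_congr rfl fun k _ => ?_
  rw [integral_finsetSum _ fun l _ => hint k l]
  refine Finset.sum_congr rfl fun l _ => integral_congr_ae ?_
  filter_upwards [hXy] with y hy
  rw [hy]

end Coefficient

/-! ### Comparison of the cell problems at `θ` and at `0` -/

lemma zero_mem_Theta (d : ℕ) : (0 : RR d) ∈ Theta d := fun j => by
  simp [Real.pi_pos, Real.pi_pos.le]

lemma gaugeShift_mem_perpSubmodule (θ : RR d) {η : RR d} {w : L2Vec n d × L2Mat n d}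
    (hw : w ∈ perpSubmodule n η) : gaugeShift n θ w ∈ perpSubmodule n (θ + η) := by
  obtain ⟨h1, h2⟩ := mem_perpSubmodule.1 hw
  refine mem_perpSubmodule.2 ⟨gaugeShift_mem_H1 θ h1, fun i => ?_⟩
  rw [gaugeShift_fst, ← modulate_wave, inner_modulate, modulate_neg_modulate, h2]

lemma norm_wave_unitMat (θ : RR d) (r : Fin n) (s : Fin d) :
    ‖wave θ (unitMat r s : CMat n d)‖ = 1 := by
  have h : ‖wave θ (unitMat r s : CMat n d)‖ ^ 2 = 1 := by
    rw [Lp_norm_sq_eq_integral]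
    have : ∫ y, ‖wave θ (unitMat r s : CMat n d) y‖ ^ 2 ∂(cellMeasure d)
        = ∫ _, (1 : ℝ) ∂(cellMeasure d) := by
      refine integral_congr_ae ?_
      filter_upwards [coeFn_wave θ (unitMat r s : CMat n d)] with y hy
      rw [hy, norm_smul, norm_planeWave]
      simp [unitMat]
    rw [this]
    simp
  exact (pow_eq_one_iff_of_nonneg (norm_nonneg _) two_ne_zero).1 h

/-- Lipschitz continuity at `0` of the entries of the fibre-homogenised tensor. -/
theorem exists_norm_ahomMatrix_sub_le {a : RR d → (CMat n d →L[ℂ] CMat n d)} (ha : IsCoeff a)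
    (ij rs : Fin n × Fin d) : ∃ C : ℝ, 0 ≤ C ∧ ∀ θ ∈ Theta d,
      ‖ahomMatrix a θ ij rs - ahomMatrix a 0 ij rs‖ ≤ C * ‖θ‖ := by
  obtain ⟨ν, hν, hA⟩ := exists_coercive_coeffOp ha
  set A := coeffOp ha with hAdef
  set N₀ := cellSolution a 0 rs.1 rs.2 with hN₀
  set p := N₀.2 + wave 0 (unitMat rs.1 rs.2) with hp
  obtain ⟨h₀, h₀'⟩ := (isCellSolution_iff ha).1
    (isCellSolution_cellSolution ha (zero_mem_Theta d) rs.1 rs.2)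
  -- The fraction is the constant in the energy estimate `h7` for `e.2`; the last summand bounds `i
  -- N₀ ⊗ θ`. Only data at `θ = 0` occur.
  refine ⟨‖A‖ * (‖A‖ * (‖p‖ + ‖N₀.1‖) / ν + ‖N₀.1‖), by positivity, fun θ hθ => ?_⟩
  set N := cellSolution a θ rs.1 rs.2 with hN
  obtain ⟨h₁, h₁'⟩ := (isCellSolution_iff ha).1
    (isCellSolution_cellSolution ha hθ rs.1 rs.2)
  set e := N - gaugeShift n θ N₀ with he
  have heθ : e ∈ perpSubmodule n θ := by
    refine sub_mem h₁ ?_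
    simpa using gaugeShift_mem_perpSubmodule θ h₀
  have hsplit : N.2 + wave θ (unitMat rs.1 rs.2)
      = e.2 + modulate θ (tensorOp n θ N₀.1) + modulate θ p := by
    have hwave : wave θ (unitMat rs.1 rs.2 : CMat n d) = modulate θ (wave 0 (unitMat rs.1 rs.2)) := by
      rw [modulate_wave, add_zero]
    rw [he, Prod.snd_sub, gaugeShift_snd, hp, hwave, map_add, map_add]
    abel
  have h1 : inner ℂ e.2 (A (e.2 + modulate θ (tensorOp n θ N₀.1) + modulate θ p)) = 0 := by
    rw [← hsplit]; exact h₁' e heθ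
  -- The problem at `0` is tested with `e^{-iθ·y} e`, and the modulation is then moved to the other
  -- side.
  have h2 : inner ℂ (e.2 - tensorOp n θ e.1) (A (modulate θ p)) = 0 := by
    have h3 : gaugeShift n (-θ) e ∈ perpSubmodule n 0 := by
      simpa using gaugeShift_mem_perpSubmodule (-θ) heθ
    have h4 := h₀' _ h3
    rw [gaugeShift_snd, tensorOp_neg, ← sub_eq_add_neg, inner_modulate, neg_neg] at h4
    rw [hAdef, coeffOp_modulate]
    exact h4
  have ht : ‖tensorOp n θ e.1‖ ≤ ‖θ‖ * ‖e.2‖ :=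
    (norm_tensorOp_le θ e.1).trans
      (mul_le_mul_of_nonneg_left (norm_fst_le hθ heθ) (norm_nonneg _))
  have hs : ‖modulate θ (tensorOp n θ N₀.1)‖ ≤ ‖θ‖ * ‖N₀.1‖ := by
    rw [norm_modulate]; exact norm_tensorOp_le θ _
  have h6 := mul_norm_le_of_inner_eq_zero A (norm_nonneg θ) hA h1 h2 ht
  rw [norm_modulate θ p] at h6
  have h7 : ‖e.2‖ ≤ ‖A‖ * (‖p‖ + ‖N₀.1‖) / ν * ‖θ‖ := by
    rw [div_mul_eq_mul_div, le_div_iff₀ hν, mul_comm ‖e.2‖]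
    refine h6.trans ?_
    rw [mul_assoc, add_mul, mul_comm ‖p‖, mul_comm ‖N₀.1‖]
    gcongr
  -- The contribution of `modulate θ p` is exactly the entry at `0`: the modulations of the two
  -- slots cancel.
  have hdiff : ahomMatrix a θ ij rs - ahomMatrix a 0 ij rs
      = inner ℂ (wave θ (unitMat ij.1 ij.2))
        (A (e.2 + modulate θ (tensorOp n θ N₀.1))) := by
    rw [ahomMatrix_eq_inner ha, ahomMatrix_eq_inner ha, ← hN, ← hN₀, hsplit, ← hp, ← hAdef,
      map_add A (_ + _), inner_add_right, add_sub_assoc, add_eq_left, sub_eq_zero]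
    have hwave : wave θ (unitMat ij.1 ij.2 : CMat n d) = modulate θ (wave 0 (unitMat ij.1 ij.2)) := by
      rw [modulate_wave, add_zero]
    rw [hwave, inner_modulate, hAdef, coeffOp_modulate, modulate_neg_modulate]
  rw [hdiff]
  refine (norm_inner_le_norm _ _).trans ?_
  rw [norm_wave_unitMat, one_mul, mul_assoc]
  refine (A.le_opNorm _).trans (mul_le_mul_of_nonneg_left ?_ (norm_nonneg _))
  refine (norm_add_le _ _).trans ?_
  rw [add_mul, mul_comm ‖N₀.1‖]
  exact add_le_add h7 hs

end

end FibreHom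

theorem proposition4p3 (n d : ℕ)
    (a : FibreHom.RR d → (FibreHom.CMat n d →L[ℂ] FibreHom.CMat n d))
    (ha : FibreHom.IsCoeff a) :
    (∀ θ ∈ FibreHom.Theta d, ∀ (r : Fin n) (s : Fin d),
        ∃! N : FibreHom.L2Vec n d × FibreHom.L2Mat n d, FibreHom.IsCellSolution a θ r s N) ∧
      ∃ κ : ℝ, 0 < κ ∧ ∀ θ ∈ FibreHom.Theta d,
        ‖FibreHom.ahom a θ - FibreHom.ahom a 0‖ ≤ κ * ‖θ‖ := by
  refine ⟨fun θ hθ r s => FibreHom.existsUnique_isCellSolution ha hθ r s, ?_⟩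
  choose C hC0 hC using FibreHom.exists_norm_ahomMatrix_sub_le ha
  let T : Matrix (Fin n × Fin d) (Fin n × Fin d) ℂ →
      (FibreHom.CMat n d →L[ℂ] FibreHom.CMat n d) :=
    Matrix.toEuclideanCLM (𝕜 := ℂ) (n := Fin n × Fin d)
  have hsum : 0 ≤ ∑ ij, ∑ rs, C ij rs * ‖T (Matrix.single ij rs 1)‖ :=
    Finset.sum_nonneg fun ij _ => Finset.sum_nonneg fun rs _ =>
      mul_nonneg (hC0 ij rs) (norm_nonneg _)
  -- The entrywise constants are weighted by the norms of the matrix units; the `+ 1` keeps `κ`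
  -- positive even if the sum is zero, for instance when `n` or `d` is `0`.
  refine ⟨∑ ij, ∑ rs, C ij rs * ‖T (Matrix.single ij rs 1)‖ + 1, by linarith, fun θ hθ => ?_⟩
  have hT : FibreHom.ahom a θ - FibreHom.ahom a 0 = ∑ ij, ∑ rs,
      (FibreHom.ahomMatrix a θ ij rs - FibreHom.ahomMatrix a 0 ij rs) •
        T (Matrix.single ij rs 1) := by
    rw [FibreHom.ahom, FibreHom.ahom, ← map_sub]
    conv_lhs => rw [Matrix.matrix_eq_sum_single (FibreHom.ahomMatrix a θ - FibreHom.ahomMatrix a 0)]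
    rw [map_sum]
    refine Finset.sum_congr rfl fun ij _ => ?_
    rw [map_sum]
    refine Finset.sum_congr rfl fun rs _ => ?_
    rw [← map_smul, Matrix.smul_single, smul_eq_mul, mul_one]
    rfl
  rw [hT, add_mul, Finset.sum_mul]
  refine ((norm_sum_le _ _).trans (Finset.sum_le_sum fun ij _ => ?_)).trans
    (le_add_of_nonneg_right (by positivity))
  rw [Finset.sum_mul]
  refine (norm_sum_le _ _).trans (Finset.sum_le_sum fun rs _ => ?_)
  rw [norm_smul, mul_right_comm]
  exact mul_le_mul_of_nonneg_right (hC ij rs θ hθ) (norm_nonneg _)
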